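/- **Definitions.** A \emph{Scott set} is a nonempty collection $\mathcal S$ of subsets of $\omega$ such that: if $X\in\mathcal S$ and $Y\le_{\mathrm T}X$ then $Y\in\mathcal S$; if $X,Y\in\mathcal S$ then $X\oplus Y\in\mathcal S$; and if $X\in\mathcal S$ and $\mathcal C=\{\sigma\in 2^\omega:\forall n\; R(\sigma\upharpoonright n)\}$ is nonempty for some $X$-computable relation $R$ on finite binary strings, then $\mathcal S$ contains an element of $\mathcal C$. A group $M$ is \emph{existentially closed} if every quantifier-free formula $\varphi(\bar x,\bar m)$ in the language $\{1,\cdot,{}^{-1}\}$ with parameters $\bar m$ from $M$ that is satisfied by some tuple $\bar x$ in some group extending $M$ is satisfied by some tuple $\bar x$ in $M$. The \emph{skeleton} $\mathrm{Sk}(M)$ is the collection of finitely generated subgroups of $M$. For a group $G$ with finite generating tuple $\bar g$, the \emph{word problem} $W(G)=W(G,\bar g)\subseteq\omega$ is the set of codes of words in $\bar g$ and formal inverses of $\bar g$ that equal $1$ in $G$; its Turing degree does not depend on $\bar g$. **Theorem.** Let $\mathcal S$ be a countable Scott set. Then there is a countable existentially closed group $M_{\mathcal S}$ such that 1. the Turing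 degrees of the word problems $W(G)$, $G\in\mathrm{Sk}(M_{\mathcal S})$, are exactly the Turing degrees of the elements of $\mathcal S$; and 2. up to isomorphism, $\mathrm{Sk}(M_{\mathcal S})$ is the class of all finitely generated groups $G$ with $W(G)\in\mathcal S$: for every group $G$ and every finite tuple $\bar g$ generating $G$, $G$ is isomorphic to a finitely generated subgroup of $M_{\mathcal S}$ if and only if $W(G,\bar g)\in\mathcal S$. -/

import Mathlib

open scoped Computability

namespace ECGroup

noncomputable section

/-! ### Sets of natural numbers, Turing degrees and Scott sets -/

open Classical in
/-- The characteristic function of a set of natural numbers. -/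
def charFun (X : Set ℕ) : ℕ →. ℕ := fun k => Part.some (if k ∈ X then 1 else 0)

/-- `SetReducible Y X`: the set `Y` is Turing reducible to the set `X`. -/
def SetReducible (Y X : Set ℕ) : Prop := charFun Y ≤ᵀ charFun X

/-- The Turing degree of a set of natural numbers. -/
def degree (X : Set ℕ) : TuringDegree := toAntisymmetrization TuringReducible (charFun X)

/-- The effective join `X ⊕ Y`. -/
def join (X Y : Set ℕ) : Set ℕ :=
  {k | (∃ x ∈ X, k = 2 * x) ∨ (∃ y ∈ Y, k = 2 * y + 1)}

open Classical in
/-- The initial segment of length `n` of `X`, seen as an infinite binary sequence. -/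
def initSeg (X : Set ℕ) (n : ℕ) : List Bool := (List.range n).map fun i => decide (i ∈ X)

open Classical in
/-- `C` is a `Π⁰₁` class relative to `X`: the class of all infinite binary sequences (identified
with subsets of `ℕ`) whose finite initial segments all lie in some `X`-computable set `R` of
finite binary strings. -/
def IsPiClass (X : Set ℕ) (C : Set (Set ℕ)) : Prop :=
  ∃ R : Set (List Bool), ComputableIn {charFun X} (fun s : List Bool => decide (s ∈ R)) ∧
    C = {Y | ∀ n, initSeg Y n ∈ R}

/-- A Scott set: a nonempty collection of subsets of `ℕ` that is closed downwards under Turing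
reducibility, closed under joins, and contains an element of every nonempty `Π⁰₁` class relative
to one of its members. -/
structure IsScottSet (S : Set (Set ℕ)) : Prop where
  nonempty : S.Nonempty
  of_reducible : ∀ X ∈ S, ∀ Y, SetReducible Y X → Y ∈ S
  join_mem : ∀ X ∈ S, ∀ Y ∈ S, join X Y ∈ S
  inter_nonempty : ∀ X ∈ S, ∀ C, IsPiClass X C → C.Nonempty → (S ∩ C).Nonempty

/-! ### The language of groups and existentially closed groups -/

/-- The function symbols of the language `{1, ·, ⁻¹}` of groups. -/
inductive GroupFunc : ℕ → Type
  | one : GroupFunc 0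
  | mul : GroupFunc 2
  | inv : GroupFunc 1

/-- The first-order language of groups. -/
def groupLang : FirstOrder.Language where
  Functions := GroupFunc
  Relations := fun _ => Empty

/-- Every group is a structure for the language of groups. -/
instance groupStructure (G : Type*) [Group G] : groupLang.Structure G where
  funMap := fun {_} f =>
    match f with
    | GroupFunc.one => fun _ => 1
    | GroupFunc.mul => fun v => v 0 * v 1
    | GroupFunc.inv => fun v => (v 0)⁻¹
  RelMap := fun r => r.elim

/-- `M` is existentially closed: every quantifier-free formula `φ(x, m)` with parameters `m`
from `M` that has a solution in some group extending `M` already has a solution in `M`.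
In `φ` the variables `Sum.inl i` are the unknowns and the `Sum.inr j` stand for the parameters;
an extension of `M` is given by an injective homomorphism `ι : M →* N`. -/
def IsExistentiallyClosed.{u} (M : Type u) [Group M] : Prop :=
  ∀ (k l : ℕ) (φ : groupLang.Formula (Fin k ⊕ Fin l)), φ.IsQF → ∀ m : Fin l → M,
    (∃ (N : Type u) (_ : Group N) (ι : M →* N), Function.Injective ι ∧
      ∃ x : Fin k → N, φ.Realize (Sum.elim x (ι ∘ m))) →
    ∃ x : Fin k → M, φ.Realize (Sum.elim x m)

/-! ### Word problems and skeletons -/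

/-- Words on `n` letters and their formal inverses; `(i, true)` is the letter `i` and
`(i, false)` is its formal inverse. Words need not be reduced. -/
abbrev Word (n : ℕ) := List (Fin n × Bool)

/-- The value of a word at a tuple of group elements. -/
def evalWord {G : Type*} [Group G] {n : ℕ} (g : Fin n → G) (w : Word n) : G :=
  (w.map fun a => if a.2 then g a.1 else (g a.1)⁻¹).prod

/-- The word problem with respect to the tuple `g`, as a set of natural numbers: the set of codes
of the words that are equal to `1`. -/
def wordProblem {G : Type*} [Group G] {n : ℕ} (g : Fin n → G) : Set ℕ :=
  {c | ∃ w : Word n, Encodable.encode w = c ∧ evalWord g w = 1}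

/-- The tuple `g` generates the group `G`. -/
def Generates {G : Type*} [Group G] {n : ℕ} (g : Fin n → G) : Prop :=
  Subgroup.closure (Set.range g) = ⊤

/-- The skeleton of `M`: the collection of its finitely generated subgroups. -/
def skeleton (M : Type*) [Group M] : Set (Subgroup M) := {H | H.FG}

/-- The set of Turing degrees of word problems of groups in the skeleton of `M`. -/
def skeletonDegrees (M : Type*) [Group M] : Set TuringDegree :=
  {d | ∃ H ∈ skeleton M, ∃ (n : ℕ) (g : Fin n → H), Generates g ∧ d = degree (wordProblem g)}

end

end ECGroup

namespace ECGroup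

open Encodable

open Classical in
lemma recursiveIn_initSeg (X : Set ℕ) :
    Nat.RecursiveIn {charFun X} fun n => Part.some (encode (initSeg X n)) := by
  have hF : Nat.Primrec fun m : ℕ => encode (((decode (α := List Bool) m.unpair.1).getD []) ++
      [decide (m.unpair.2 = 1)]) := by
    refine Primrec.nat_iff.1 (Primrec.encode.comp (Primrec.list_append.comp ?_ ?_))
    · exact Primrec.option_getD.comp (Primrec.decode.comp (Primrec.fst.comp Primrec.unpair))
        (Primrec.const [])
    · exact Primrec.list_cons.comp ((Primrec.eq.comp (Primrec.snd.comp Primrec.unpair)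
        (Primrec.const 1)).decide) (Primrec.const [])
  have hpr : Nat.RecursiveIn {charFun X} fun m => Part.some m.unpair.2.unpair.2 :=
    (Primrec.nat_iff.1 (Primrec.snd.comp (Primrec.unpair.comp
      (Primrec.snd.comp Primrec.unpair)))).recursiveIn
  have hy : Nat.RecursiveIn {charFun X} fun m => Part.some m.unpair.2.unpair.1 :=
    (Primrec.nat_iff.1 (Primrec.fst.comp (Primrec.unpair.comp
      (Primrec.snd.comp Primrec.unpair)))).recursiveIn
  have horacle : Nat.RecursiveIn {charFun X} fun k => Part.some (if k ∈ X then 1 else 0) :=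
    .oracle _ rfl
  have hstep := Nat.RecursiveIn.comp hF.recursiveIn
    (Nat.RecursiveIn.pair hpr (Nat.RecursiveIn.comp horacle hy))
  have hbase : Nat.RecursiveIn {charFun X} fun _ => Part.some (encode ([] : List Bool)) :=
    (Nat.Primrec.const _).recursiveIn
  have hprec := Nat.RecursiveIn.prec hbase hstep
  have harg : Nat.RecursiveIn {charFun X} fun n : ℕ => Part.some (Nat.pair 0 n) :=
    (Primrec.nat_iff.1 (Primrec₂.natPair.comp (Primrec.const 0) Primrec.id)).recursiveIn
  refine (Nat.RecursiveIn.comp hprec harg).of_eq fun n => ?_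
  simp only [Part.bind_eq_bind, Part.bind_some, Nat.unpair_pair]
  induction n with
  | zero => rfl
  | succ n ih =>
    simp only [ih, Part.bind_some]
    by_cases hn : n ∈ X <;> simp [Seq.seq, initSeg, List.range_succ, hn]

/-- Truth-table reductions: a computable function of the input and of an initial segment of the
oracle of computable length is computable in the oracle. -/
lemma computableIn_initSeg {α σ : Type*} [Primcodable α] [Primcodable σ] (X : Set ℕ)
    {F : α × List Bool → σ} {b : α → ℕ} (hF : Primrec F) (hb : Primrec b) :
    ComputableIn {charFun X} fun a => F (a, initSeg X (b a)) := by
  have hB : Nat.Primrec fun n => ((decode (α := α) n).map b).getD 0 :=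
    Primrec.nat_iff.1 (Primrec.option_getD.comp
      (Primrec.option_map Primrec.decode (hb.comp Primrec.snd).to₂) (Primrec.const 0))
  have hid : Nat.RecursiveIn {charFun X} fun n => Part.some n :=
    (Primrec.nat_iff.1 Primrec.id).recursiveIn
  have h1 := Nat.RecursiveIn.pair hid
    (Nat.RecursiveIn.comp (recursiveIn_initSeg X) hB.recursiveIn)
  have h2 : Nat.RecursiveIn {charFun X} _ := (hF.computableIn (O := {charFun X}))
  refine (Nat.RecursiveIn.comp h2 h1).of_eq fun n => ?_
  cases h : decode (α := α) n with
  | none => simp [h, Seq.seq]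
  | some a => simp [h, Seq.seq]

open Classical in
lemma setReducible_of_primrec {X Y : Set ℕ} {P : ℕ × List Bool → Prop} {b : ℕ → ℕ}
    (hP : PrimrecPred P) (hb : Primrec b) (h : ∀ k, k ∈ Y ↔ P (k, initSeg X (b k))) :
    SetReducible Y X := by
  have := computableIn_initSeg X (F := fun p => if P p then 1 else 0) (b := b)
    (Primrec.ite hP (Primrec.const 1) (Primrec.const 0)) hb
  refine RecursiveIn.of_eq this fun k => ?_
  simp [charFun, h]

lemma initSeg_length (X : Set ℕ) (n : ℕ) : (initSeg X n).length = n := by simp [initSeg]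

open Classical in
lemma initSeg_getElem? (X : Set ℕ) (n k : ℕ) :
    (initSeg X n)[k]? = if k < n then some (decide (k ∈ X)) else none := by
  simp only [initSeg, List.getElem?_map]
  split_ifs with h <;> simp [h]

/-- The literal `l` is not refuted by the string `s`. -/
def NotRefuted (l : ℕ × Bool) (s : List Bool) : Prop := (s[l.1]?).getD l.2 = l.2

lemma primrec_notRefuted : PrimrecRel NotRefuted :=
  Primrec.eq.comp (Primrec.option_getD.comp
    (Primrec.list_getElem?.comp Primrec.snd (Primrec.fst.comp Primrec.fst))
    (Primrec.snd.comp Primrec.fst)) (Primrec.snd.comp Primrec.fst)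

lemma notRefuted_of_mem_iff {X : Set ℕ} {l : ℕ × Bool} (h : l.1 ∈ X ↔ l.2 = true) (n : ℕ) :
    NotRefuted l (initSeg X n) := by
  obtain ⟨k, b⟩ := l
  simp only at h
  rw [NotRefuted, initSeg_getElem?]
  split_ifs <;> cases b <;> simp_all

lemma NotRefuted.mem_iff {X : Set ℕ} {l : ℕ × Bool} {n : ℕ} (h : NotRefuted l (initSeg X n))
    (hn : l.1 < n) : l.1 ∈ X ↔ l.2 = true := by
  obtain ⟨k, b⟩ := l
  simp only at hn
  rw [NotRefuted, initSeg_getElem?] at h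
  cases b <;> simp_all

/-- The clause with the literals `l` about one set and `m` about another is not refuted by the
strings `p.1` and `p.2`. -/
def ClauseNotRefuted (l m : List (ℕ × Bool)) (p : List Bool × List Bool) : Prop :=
  (∃ x ∈ l, NotRefuted x p.1) ∨ ∃ x ∈ m, NotRefuted x p.2

/-- The clause with the literals `l` about `Y` and `m` about `Z` is true. -/
def ClauseTrue (l m : List (ℕ × Bool)) (Y Z : Set ℕ) : Prop :=
  (∃ x ∈ l, (x.1 ∈ Y ↔ x.2 = true)) ∨ ∃ x ∈ m, (x.1 ∈ Z ↔ x.2 = true)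

lemma forall_clauseNotRefuted_iff {β : Type*} [Encodable β] (l m : β → List (ℕ × Bool))
    (Y Z : Set ℕ) :
    (∀ n, ∀ i < n, ∀ b ∈ decode (α := β) i,
      ClauseNotRefuted (l b) (m b) (initSeg Y n, initSeg Z n)) ↔
    ∀ b, ClauseTrue (l b) (m b) Y Z := by
  constructor
  · intro h b
    obtain ⟨N, hN⟩ : ∃ N, ∀ x ∈ l b ++ m b, x.1 < N :=
      ⟨((l b ++ m b).map Prod.fst).sum + 1, fun x hx => Nat.lt_succ_of_le
        (List.single_le_sum (by simp) _ (List.mem_map_of_mem hx))⟩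
    have := h (N + encode b + 1) (encode b) (by omega) b (by simp)
    rcases this with ⟨x, hx, hr⟩ | ⟨x, hx, hr⟩
    · exact Or.inl ⟨x, hx, hr.mem_iff (by have := hN x (by simp [hx]); omega)⟩
    · exact Or.inr ⟨x, hx, hr.mem_iff (by have := hN x (by simp [hx]); omega)⟩
  · intro h n i _ b _
    rcases h b with ⟨x, hx, hr⟩ | ⟨x, hx, hr⟩
    · exact Or.inl ⟨x, hx, notRefuted_of_mem_iff hr n⟩
    · exact Or.inr ⟨x, hx, notRefuted_of_mem_iff hr n⟩

open Classical in
lemma isPiClass_clauses (Z : Set ℕ) {β : Type*} [Primcodable β] {l m : β → List (ℕ × Bool)}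
    (hl : Primrec l) (hm : Primrec m) :
    IsPiClass Z {Y | ∀ b, ClauseTrue (l b) (m b) Y Z} := by
  have hQ : PrimrecPred fun q : β × (List Bool × List Bool) =>
      ClauseNotRefuted (l q.1) (m q.1) q.2 :=
    (primrec_notRefuted.exists_mem_list.comp (hl.comp Primrec.fst)
      (Primrec.fst.comp Primrec.snd)).or
    (primrec_notRefuted.exists_mem_list.comp (hm.comp Primrec.fst)
      (Primrec.snd.comp Primrec.snd))
  have hR : PrimrecRel fun (i : ℕ) (p : List Bool × List Bool) =>
      ∀ b ∈ decode (α := β) i, ClauseNotRefuted (l b) (m b) p := by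
    have : PrimrecRel fun (i : ℕ) (p : List Bool × List Bool) =>
        (((decode (α := β) i).map fun b => decide (ClauseNotRefuted (l b) (m b) p)).getD true)
          = true :=
      Primrec.eq.comp (Primrec.option_getD.comp (Primrec.option_map
        (Primrec.decode.comp Primrec.fst)
        (hQ.decide.comp (Primrec.pair Primrec.snd (Primrec.snd.comp Primrec.fst))).to₂)
        (Primrec.const true)) (Primrec.const true)
    refine this.of_eq fun i p => ?_
    cases decode (α := β) i <;> simp
  have hP : PrimrecPred fun p : List Bool × List Bool => ∀ i < p.1.length,
      ∀ b ∈ decode (α := β) i, ClauseNotRefuted (l b) (m b) p :=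
    (PrimrecRel.comp hR.forall_mem_list
      (Primrec.list_range.comp (Primrec.list_length.comp Primrec.fst)) Primrec.id).of_eq
      fun p => by simp
  refine ⟨{s | ∀ i < s.length, ∀ b ∈ decode (α := β) i,
    ClauseNotRefuted (l b) (m b) (s, initSeg Z s.length)}, ?_, ?_⟩
  · convert computableIn_initSeg Z hP.decide Primrec.list_length
    exact Iff.rfl
  · ext Y
    simp only [Set.mem_ofPred_eq, initSeg_length]
    exact (forall_clauseNotRefuted_iff l m Y Z).symm

/-- `C` is the class of solutions of a primitive recursive list of clauses, with literals about
the unknown set and about `Z`. -/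
def IsClauseClass (Z : Set ℕ) (C : Set (Set ℕ)) : Prop :=
  ∃ (β : Type) (_ : Primcodable β) (l m : β → List (ℕ × Bool)), Primrec l ∧ Primrec m ∧
    C = {Y | ∀ b, ClauseTrue (l b) (m b) Y Z}

lemma IsClauseClass.isPiClass {Z : Set ℕ} {C : Set (Set ℕ)} (h : IsClauseClass Z C) :
    IsPiClass Z C := by
  obtain ⟨β, _, l, m, hl, hm, rfl⟩ := h
  exact isPiClass_clauses Z hl hm

lemma IsClauseClass.inter {Z : Set ℕ} {C D : Set (Set ℕ)} (hC : IsClauseClass Z C)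
    (hD : IsClauseClass Z D) : IsClauseClass Z (C ∩ D) := by
  obtain ⟨β, _, l, m, hl, hm, rfl⟩ := hC
  obtain ⟨γ, _, l', m', hl', hm', rfl⟩ := hD
  refine ⟨β ⊕ γ, inferInstance, Sum.elim l l', Sum.elim m m', ?_, ?_, ?_⟩
  · exact (Primrec.sumCasesOn Primrec.id (hl.comp Primrec.snd).to₂
      (hl'.comp Primrec.snd).to₂).of_eq fun x => by cases x <;> rfl
  · exact (Primrec.sumCasesOn Primrec.id (hm.comp Primrec.snd).to₂
      (hm'.comp Primrec.snd).to₂).of_eq fun x => by cases x <;> rfl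
  · ext Y; simp

/-- Horn clauses about the unknown set: if all elements of `f b` belong to it, then so does
`g b`. -/
lemma isClauseClass_imp (Z : Set ℕ) {β : Type} [Primcodable β] {f : β → List ℕ} {g : β → ℕ}
    (hf : Primrec f) (hg : Primrec g) :
    IsClauseClass Z {Y | ∀ b, (∀ k ∈ f b, k ∈ Y) → g b ∈ Y} := by
  refine ⟨β, inferInstance, fun b => (g b, true) :: (f b).map fun k => (k, false), fun _ => [],
    ?_, Primrec.const _, ?_⟩
  · exact Primrec.list_cons.comp (Primrec.pair hg (Primrec.const true))
      (Primrec.list_map hf (Primrec.pair Primrec.snd (Primrec.const false)).to₂)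
  · ext Y
    simp only [Set.mem_ofPred_eq]
    refine forall_congr' fun b => ?_
    simp [ClauseTrue]
    grind

lemma isClauseClass_iff (Z : Set ℕ) {β : Type} [Primcodable β] {f g : β → ℕ}
    (hf : Primrec f) (hg : Primrec g) :
    IsClauseClass Z {Y | ∀ b, f b ∈ Y ↔ g b ∈ Z} := by
  refine ⟨β × Bool, inferInstance, fun b => [(f b.1, b.2)], fun b => [(g b.1, !b.2)], ?_, ?_, ?_⟩
  · exact Primrec.list_cons.comp (Primrec.pair (hf.comp Primrec.fst) Primrec.snd)
      (Primrec.const _)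
  · exact Primrec.list_cons.comp (Primrec.pair (hg.comp Primrec.fst)
      (Primrec.not.comp Primrec.snd)) (Primrec.const _)
  · ext Y
    simp only [Set.mem_ofPred_eq, Prod.forall, Bool.forall_bool]
    refine forall_congr' fun b => ?_
    simp [ClauseTrue]
    tauto

/-- The set of codes of the words on infinitely many letters whose value lies in `K`. -/
def wordSet (K : Subgroup (FreeGroup ℕ)) : Set ℕ :=
  {c | ∃ w : List (ℕ × Bool), encode w = c ∧ FreeGroup.mk w ∈ K}

lemma encode_mem_wordSet {K : Subgroup (FreeGroup ℕ)} {w : List (ℕ × Bool)} :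
    encode w ∈ wordSet K ↔ FreeGroup.mk w ∈ K :=
  ⟨fun ⟨_, hw, h⟩ => encode_injective hw ▸ h, fun h => ⟨w, rfl, h⟩⟩

/-- The conditions on `Y` under which the words with code in `Y` are those with value in some
normal subgroup. -/
structure IsNormalWordSet (Y : Set ℕ) : Prop where
  nil : encode ([] : List (ℕ × Bool)) ∈ Y
  append : ∀ u v : List (ℕ × Bool), encode u ∈ Y → encode v ∈ Y → encode (u ++ v) ∈ Y
  invRev : ∀ u : List (ℕ × Bool), encode u ∈ Y → encode (FreeGroup.invRev u) ∈ Y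
  conj : ∀ u v : List (ℕ × Bool), encode u ∈ Y → encode (v ++ u ++ FreeGroup.invRev v) ∈ Y
  insert : ∀ (u v : List (ℕ × Bool)) (x : ℕ × Bool), encode (u ++ v) ∈ Y →
    encode (u ++ (x.1, x.2) :: (x.1, !x.2) :: v) ∈ Y
  erase : ∀ (u v : List (ℕ × Bool)) (x : ℕ × Bool),
    encode (u ++ (x.1, x.2) :: (x.1, !x.2) :: v) ∈ Y → encode (u ++ v) ∈ Y

lemma isNormalWordSet_wordSet (K : Subgroup (FreeGroup ℕ)) [hK : K.Normal] :
    IsNormalWordSet (wordSet K) := by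
  have step : ∀ (u v : List (ℕ × Bool)) (x : ℕ × Bool),
      (FreeGroup.mk (u ++ (x.1, x.2) :: (x.1, !x.2) :: v)) = FreeGroup.mk (u ++ v) :=
    fun u v x => Quot.sound FreeGroup.Red.Step.not
  constructor <;> simp only [encode_mem_wordSet]
  · exact K.one_mem
  · intro u v hu hv
    rw [← FreeGroup.mul_mk]; exact K.mul_mem hu hv
  · intro u hu
    rw [← FreeGroup.inv_mk]; exact K.inv_mem hu
  · intro u v hu
    rw [← FreeGroup.mul_mk, ← FreeGroup.mul_mk, ← FreeGroup.inv_mk]; exact hK.conj_mem _ hu _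
  · intro u v x h; rwa [step]
  · intro u v x h; rwa [step] at h

lemma IsNormalWordSet.exists_subgroup {Y : Set ℕ} (h : IsNormalWordSet Y) :
    ∃ K : Subgroup (FreeGroup ℕ), K.Normal ∧ ∀ w, FreeGroup.mk w ∈ K ↔ encode w ∈ Y := by
  let P : FreeGroup ℕ → Prop := Quot.lift (fun w => encode w ∈ Y) fun a b hab => by
    cases hab with
    | @not u v x b => exact propext ⟨h.erase u v (x, b), h.insert u v (x, b)⟩
  have hP : ∀ w, P (FreeGroup.mk w) ↔ encode w ∈ Y := fun w => Iff.rfl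
  refine ⟨{ carrier := {x | P x}, one_mem' := ?_, mul_mem' := ?_, inv_mem' := ?_ }, ⟨?_⟩, hP⟩
  · intro a b
    induction a using Quot.ind; induction b using Quot.ind
    exact h.append _ _
  · exact h.nil
  · intro a
    induction a using Quot.ind
    exact h.invRev _
  · intro a ha b
    induction a using Quot.ind; induction b using Quot.ind
    exact h.conj _ _ ha

lemma primrec_invRev : Primrec (FreeGroup.invRev : List (ℕ × Bool) → List (ℕ × Bool)) :=
  Primrec.list_reverse.comp (Primrec.list_map Primrec.id
    (Primrec.pair (Primrec.fst.comp Primrec.snd)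
      (Primrec.not.comp (Primrec.snd.comp Primrec.snd))).to₂)

lemma isClauseClass_isNormalWordSet (Z : Set ℕ) :
    IsClauseClass Z {Y | IsNormalWordSet Y} := by
  let L := List (ℕ × Bool)
  have enc : Primrec fun w : L => encode w := Primrec.encode
  have single : ∀ {β : Type} [Primcodable β] {f : β → ℕ}, Primrec f → Primrec fun b => [f b] :=
    fun hf => Primrec.list_cons.comp hf (Primrec.const [])
  have e1 := isClauseClass_imp Z (β := Unit) (f := fun _ => []) (g := fun _ => encode ([] : L))
    (Primrec.const _) (Primrec.const _)
  have e2 := isClauseClass_imp Z (β := L × L) (f := fun b => [encode b.1, encode b.2])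
    (g := fun b => encode (b.1 ++ b.2))
    (Primrec.list_cons.comp (enc.comp Primrec.fst) (single (enc.comp Primrec.snd)))
    (enc.comp (Primrec.list_append.comp Primrec.fst Primrec.snd))
  have e3 := isClauseClass_imp Z (β := L) (f := fun b => [encode b])
    (g := fun b => encode (FreeGroup.invRev b)) (single enc) (enc.comp primrec_invRev)
  have e4 := isClauseClass_imp Z (β := L × L) (f := fun b => [encode b.1])
    (g := fun b => encode (b.2 ++ b.1 ++ FreeGroup.invRev b.2)) (single (enc.comp Primrec.fst))
    (enc.comp (Primrec.list_append.comp (Primrec.list_append.comp Primrec.snd Primrec.fst)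
      (primrec_invRev.comp Primrec.snd)))
  have s : Primrec fun b : L × L × (ℕ × Bool) => encode (b.1 ++ b.2.1) :=
    enc.comp (Primrec.list_append.comp Primrec.fst (Primrec.fst.comp Primrec.snd))
  have t : Primrec fun b : L × L × (ℕ × Bool) =>
      encode (b.1 ++ (b.2.2.1, b.2.2.2) :: (b.2.2.1, !b.2.2.2) :: b.2.1) :=
    enc.comp (Primrec.list_append.comp Primrec.fst (Primrec.list_cons.comp
      (Primrec.snd.comp Primrec.snd) (Primrec.list_cons.comp
        (Primrec.pair (Primrec.fst.comp (Primrec.snd.comp Primrec.snd))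
          (Primrec.not.comp (Primrec.snd.comp (Primrec.snd.comp Primrec.snd))))
        (Primrec.fst.comp Primrec.snd))))
  have e5 := isClauseClass_imp Z (single s) t
  have e6 := isClauseClass_imp Z (single t) s
  convert e1.inter (e2.inter (e3.inter (e4.inter (e5.inter e6)))) using 1
  ext Y
  simp only [Set.mem_inter_iff, Set.mem_ofPred_eq]
  constructor
  · rintro ⟨h1, h2, h3, h4, h5, h6⟩
    exact ⟨fun _ _ => h1, fun b hb => h2 _ _ (hb _ (by simp)) (hb _ (by simp)),
      fun b hb => h3 _ (hb _ (by simp)), fun b hb => h4 _ _ (hb _ (by simp)),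
      fun b hb => h5 _ _ _ (hb _ (by simp)), fun b hb => h6 _ _ b.2.2 (hb _ (by simp))⟩
  · rintro ⟨h1, h2, h3, h4, h5, h6⟩
    exact ⟨h1 () (by simp), fun u v hu hv => h2 (u, v) (by simp [hu, hv]),
      fun u hu => h3 u (by simp [hu]), fun u v hu => h4 (u, v) (by simp [hu]),
      fun u v x hu => h5 (u, v, x) (by simpa using hu),
      fun u v x hu => h6 (u, v, x) (by simpa using hu)⟩

open Classical in
/-- Truth-table reductions of sets of codes. -/
lemma setReducible_of_decode {β : Type} [Primcodable β] {X : Set ℕ} {Q : β × List Bool → Prop}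
    {b : β → ℕ} (hQ : PrimrecPred Q) (hb : Primrec b) :
    SetReducible {c | ∃ w : β, encode w = c ∧ Q (w, initSeg X (b w))} X := by
  refine setReducible_of_primrec (b := fun c => ((decode₂ β c).map b).getD 0)
    (P := fun p => (((decode₂ β p.1).map fun w => decide (Q (w, p.2))).getD false) = true)
    (Primrec.eq.comp (Primrec.option_getD.comp (Primrec.option_map
      (Primrec.decode₂.comp Primrec.fst) (hQ.decide.comp (Primrec.pair Primrec.snd
        (Primrec.snd.comp Primrec.fst))).to₂) (Primrec.const _)) (Primrec.const _))
    (Primrec.option_getD.comp (Primrec.option_map Primrec.decode₂ (hb.comp Primrec.snd).to₂)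
      (Primrec.const 0)) fun c => ?_
  cases h : decode₂ β c with
  | none =>
    simp only [Option.map_none, Option.getD_none, Set.mem_ofPred_eq]
    constructor
    · rintro ⟨w, rfl, _⟩
      simp at h
    · simp
  | some w =>
    rw [decode₂_eq_some] at h
    subst h
    simp

/-- Many-one reductions of sets of codes. -/
lemma setReducible_of_decode_mem {β : Type} [Primcodable β] {X : Set ℕ} {f : β → ℕ}
    (hf : Primrec f) : SetReducible {c | ∃ b : β, encode b = c ∧ f b ∈ X} X := by
  have := setReducible_of_decode (X := X) (b := fun w => f w + 1)
    (Q := fun p => p.2[f p.1]? = some true)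
    (Primrec.eq.comp (Primrec.list_getElem?.comp Primrec.snd (hf.comp Primrec.fst))
      (Primrec.const _)) (Primrec.succ.comp hf)
  simpa [initSeg_getElem?] using this

section

variable {S : Set (Set ℕ)}

lemma IsScottSet.decode_mem (hS : IsScottSet S) {X : Set ℕ} (hX : X ∈ S) {β : Type}
    [Primcodable β] {f : β → ℕ} (hf : Primrec f) : {c | ∃ b : β, encode b = c ∧ f b ∈ X} ∈ S :=
  hS.of_reducible X hX _ (setReducible_of_decode_mem hf)

/-- If a decidable part of the word problem of a marked group belongs to a Scott set, then it is
also part of the word problem of a marked group with word problem in the Scott set. -/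
lemma IsScottSet.exists_subgroup (hS : IsScottSet S) {α : Type} [Primcodable α]
    {e : α → List (ℕ × Bool)} (he : Primrec e) (N : Subgroup (FreeGroup ℕ)) [N.Normal]
    (hN : {c | ∃ a, encode a = c ∧ FreeGroup.mk (e a) ∈ N} ∈ S) :
    ∃ K : Subgroup (FreeGroup ℕ), K.Normal ∧ wordSet K ∈ S ∧
      ∀ a, FreeGroup.mk (e a) ∈ K ↔ FreeGroup.mk (e a) ∈ N := by
  set Z := {c | ∃ a, encode a = c ∧ FreeGroup.mk (e a) ∈ N}
  have hZ : ∀ a, encode a ∈ Z ↔ FreeGroup.mk (e a) ∈ N := fun a =>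
    ⟨fun ⟨_, hb, h⟩ => encode_injective hb ▸ h, fun h => ⟨a, rfl, h⟩⟩
  obtain ⟨Y, hYS, hY, hYZ⟩ := hS.inter_nonempty Z hN _
    ((isClauseClass_isNormalWordSet Z).inter (isClauseClass_iff Z (Primrec.encode.comp he)
      Primrec.encode)).isPiClass
    ⟨wordSet N, isNormalWordSet_wordSet N, fun a => encode_mem_wordSet.trans (hZ a).symm⟩
  obtain ⟨K, hK, hKY⟩ := hY.exists_subgroup
  refine ⟨K, hK, ?_, fun a => (hKY _).trans ((hYZ a).trans (hZ a))⟩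
  simp only [wordSet, hKY]
  exact hS.decode_mem hYS Primrec.encode

end

noncomputable section CodingGroup

/-- The states `(n, v, c)` on which the coding group acts: a position, a lamp configuration and
a sequence of counters modulo two. -/
abbrev CodingState := ℤ × (ℤ → ZMod 2) × (ℕ → ZMod 2)

/-- The generator that moves to the next position. -/
def codingShift : Equiv.Perm CodingState where
  toFun s := (s.1 + 1, s.2)
  invFun s := (s.1 - 1, s.2)
  left_inv s := by simp
  right_inv s := by simp

open Classical in
/-- The increment of the counters at position `n` in the configuration `v`. -/
def codingIncr (X : Set ℕ) (n : ℤ) (v : ℤ → ZMod 2) (k : ℕ) : ZMod 2 :=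
  if k ∈ X then v (n - k - 1) else 0

/-- The generator that switches the lamp at the current position and, for `k ∈ X`, adds the lamp
at distance `k + 1` to the left to the `k`-th counter. -/
def codingSwitch (X : Set ℕ) : Equiv.Perm CodingState :=
  Function.Involutive.toPerm
    (fun s => (s.1, s.2.1 + Pi.single s.1 1, s.2.2 + codingIncr X s.1 s.2.1)) <| by
    rintro ⟨n, v, c⟩
    have h2 : ∀ x : ZMod 2, x + x = 0 := by decide
    refine Prod.ext rfl (Prod.ext ?_ ?_)
    · funext i
      simp [add_assoc, h2]
    · funext k
      have : (n : ℤ) - k - 1 ≠ n := by omega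
      simp [codingIncr, add_assoc, this, h2]

/-- The generators of the coding group of `X`. -/
def codingGen (X : Set ℕ) : Fin 2 → Equiv.Perm CodingState := ![codingShift, codingSwitch X]

/-- One letter read by the machine that computes the final position, as a formal difference of
natural numbers, and the list of the positions of the switches. -/
def codingStep (a : Fin 2 × Bool) (s : (ℕ × ℕ) × List (ℕ × ℕ)) : (ℕ × ℕ) × List (ℕ × ℕ) :=
  if a.1 = 0 then (if a.2 then (s.1.1 + 1, s.1.2) else (s.1.1, s.1.2 + 1), s.2)
  else (s.1, s.1 :: s.2)

/-- The final position and the positions of the switches along a word. -/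
def codingRun (w : Word 2) : (ℕ × ℕ) × List (ℕ × ℕ) := w.foldr codingStep ((0, 0), [])

/-- The integer denoted by a formal difference. -/
def pos (p : ℕ × ℕ) : ℤ := (p.1 : ℤ) - p.2

/-- The number of elements of `L` at distance `d` to the left of `p`. -/
def countLeft (d : ℕ) (p : ℕ × ℕ) (L : List (ℕ × ℕ)) : ℕ :=
  (L.filter fun q => p.1 + q.2 = q.1 + p.2 + d).length

/-- The number of pairs of switches for which the later one is at distance `d` to the right. -/
def countPairs (d : ℕ) (L : List (ℕ × ℕ)) : ℕ :=
  (L.foldr (fun p s => (s.1 + countLeft d p s.2, p :: s.2)) ((0, []) : ℕ × List (ℕ × ℕ))).1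

lemma countPairs_nil (d : ℕ) : countPairs d [] = 0 := rfl

lemma countPairs_cons (d : ℕ) (p : ℕ × ℕ) (L : List (ℕ × ℕ)) :
    countPairs d (p :: L) = countPairs d L + countLeft d p L := by
  have : ∀ L : List (ℕ × ℕ), (L.foldr (fun p s => (s.1 + countLeft d p s.2, p :: s.2))
      ((0, []) : ℕ × List (ℕ × ℕ))).2 = L := by
    intro L
    induction L with
    | nil => rfl
    | cons a L ih => simp [ih]
  simp [countPairs, this]

lemma sum_single_pos (n : ℤ) (L : List (ℕ × ℕ)) (z : ℤ) :
    ((L.map fun q => (Pi.single (n + pos q) 1 : ℤ → ZMod 2)).sum) z =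
      ((L.filter fun q => n + pos q = z).length : ZMod 2) := by
  induction L with
  | nil => rfl
  | cons a L ih =>
    rw [List.map_cons, List.sum_cons, Pi.add_apply, ih, List.filter_cons]
    by_cases h : n + pos a = z
    · simp [h, add_comm]
    · simp [h, Ne.symm h]

lemma countLeft_eq (d : ℕ) (p : ℕ × ℕ) (L : List (ℕ × ℕ)) :
    countLeft d p L = (L.filter fun q => pos q = pos p - d).length := by
  unfold countLeft
  congr 2
  funext q
  refine decide_eq_decide.2 ?_
  simp only [pos]
  omega

open Classical in
lemma evalWord_codingGen_apply (X : Set ℕ) (w : Word 2) (n : ℤ) (v : ℤ → ZMod 2)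
    (c : ℕ → ZMod 2) :
    evalWord (codingGen X) w (n, v, c) =
      (n + pos (codingRun w).1,
        v + ((codingRun w).2.map fun q => (Pi.single (n + pos q) 1 : ℤ → ZMod 2)).sum,
        c + fun k => if k ∈ X then ((codingRun w).2.map fun q => v (n + pos q - k - 1)).sum +
          (countPairs (k + 1) (codingRun w).2 : ZMod 2) else 0) := by
  induction w with
  | nil => simp [evalWord, codingRun, pos, countPairs_nil, Pi.zero_def]
  | cons a w ih =>
    have hrun : codingRun (a :: w) = codingStep a (codingRun w) := rfl
    have hev : evalWord (codingGen X) (a :: w) =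
      (if a.2 then codingGen X a.1 else (codingGen X a.1)⁻¹) * evalWord (codingGen X) w := by
      simp [evalWord]
    rw [hev, Equiv.Perm.mul_apply, ih, hrun]
    generalize codingRun w = r
    obtain ⟨p, L⟩ := r
    obtain ⟨i, b⟩ := a
    have hsw : (if b then codingSwitch X else (codingSwitch X)⁻¹) = codingSwitch X := by
      cases b
      · rfl
      · rfl
    obtain rfl | rfl : i = 0 ∨ i = 1 := by omega
    · cases b
      · refine Prod.ext ?_ rfl
        simp [codingGen, codingStep, pos, codingShift, Equiv.Perm.inv_def]
        ring
      · refine Prod.ext ?_ rfl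
        simp [codingGen, codingStep, pos, codingShift]
        ring
    · have : (if (((1 : Fin 2), b) : Fin 2 × Bool).2 then codingGen X 1 else (codingGen X 1)⁻¹)
        = codingSwitch X := hsw
      refine (congrFun (congrArg _ this) _).trans ?_
      have hL : codingStep ((1 : Fin 2), b) (p, L) = (p, p :: L) := rfl
      refine Prod.ext rfl (Prod.ext ?_ ?_)
      · change v + _ + Pi.single (n + pos p) 1 = v + _
        simp only [hL, List.map_cons, List.sum_cons]
        rw [add_assoc, add_comm (List.sum _)]
      · change c + _ + codingIncr X (n + pos p) (v + _) = c + _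
        rw [add_assoc]
        congr 1
        funext k
        simp only [hL, Pi.add_apply, codingIncr, List.map_cons, List.sum_cons, countPairs_cons]
        split_ifs
        · rw [sum_single_pos, countLeft_eq]
          have : (fun q : ℕ × ℕ => decide (n + pos q = n + pos p - k - 1)) =
              fun q => decide (pos q = pos p - ((k + 1 : ℕ) : ℤ)) := by
            funext q
            refine decide_eq_decide.2 ?_
            push_cast
            omega
          rw [this]
          push_cast
          ring
        · simp

lemma sum_map_pos_eq_zero {L : List (ℕ × ℕ)} (h : ∀ q ∈ L, Even (countLeft 0 q L))
    (f : ℤ → ZMod 2) : (L.map fun q => f (pos q)).sum = 0 := by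
  have hc : ∀ z, (L.map pos).count z = (L.filter fun q => pos q = z).length := by
    intro z
    rw [List.count, List.countP_map, List.countP_eq_length_filter]
    rfl
  have := Finset.sum_list_map_count (L.map pos) f
  rw [List.map_map] at this
  refine this.trans (Finset.sum_eq_zero fun z hz => ?_)
  obtain ⟨q, hq, rfl⟩ := List.mem_map.1 (List.mem_toFinset.1 hz)
  have h2 : (((L.map pos).count (pos q) : ℕ) : ZMod 2) = 0 := by
    rw [ZMod.natCast_eq_zero_iff_even, hc]
    simpa [countLeft_eq] using h q hq
  rw [nsmul_eq_mul, h2, zero_mul]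

open Classical in
lemma evalWord_codingGen_eq_one_iff (X : Set ℕ) (w : Word 2) :
    evalWord (codingGen X) w = 1 ↔ (codingRun w).1.1 = (codingRun w).1.2 ∧
      (∀ q ∈ (codingRun w).2, Even (countLeft 0 q (codingRun w).2)) ∧
      ∀ k ∈ X, Even (countPairs (k + 1) (codingRun w).2) := by
  constructor
  · intro h
    have h0 := evalWord_codingGen_apply X w 0 0 0
    rw [h] at h0
    simp only [Equiv.Perm.one_apply, Prod.ext_iff, zero_add] at h0
    obtain ⟨hp, hv, hc⟩ := h0
    refine ⟨by simp only [pos] at hp; omega, fun q _ => ?_, fun k hk => ?_⟩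
    · have := congrFun hv (pos q)
      have h1 := sum_single_pos 0 (codingRun w).2 (pos q)
      simp only [zero_add] at h1
      rw [h1] at this
      rw [countLeft_eq, ← ZMod.natCast_eq_zero_iff_even]
      simpa using this.symm
    · have := congrFun hc k
      simp only [hk, if_true, Pi.zero_apply] at this
      rw [← ZMod.natCast_eq_zero_iff_even]
      simpa using this.symm
  · rintro ⟨hp, hv, hc⟩
    refine Equiv.ext fun s => ?_
    obtain ⟨n, v, c⟩ := s
    rw [evalWord_codingGen_apply, Equiv.Perm.one_apply]
    refine Prod.ext (by simp [pos, hp]) (Prod.ext ?_ ?_)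
    · have : ((codingRun w).2.map fun q => (Pi.single (n + pos q) 1 : ℤ → ZMod 2)).sum = 0 := by
        funext z
        refine (map_list_sum (Pi.evalAddMonoidHom (fun _ : ℤ => ZMod 2) z) _).trans ?_
        rw [List.map_map]
        exact sum_map_pos_eq_zero hv fun i => (Pi.single (n + i) 1 : ℤ → ZMod 2) z
      simp [this]
    · have : ∀ k : ℕ, ((codingRun w).2.map fun q => v (n + pos q - k - 1)).sum = 0 :=
        fun k => sum_map_pos_eq_zero hv fun i => v (n + i - k - 1)
      simp only [this, zero_add]
      have h2 : (fun k => if k ∈ X then (countPairs (k + 1) (codingRun w).2 : ZMod 2) else 0) = 0 := by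
        funext k
        split_ifs with hk
        · exact (ZMod.natCast_eq_zero_iff_even).2 (hc k hk)
        · rfl
      simp [h2]

lemma countPairs_eq_zero {d B : ℕ} {L : List (ℕ × ℕ)} (hB : ∀ q ∈ L, q.1 + q.2 ≤ B)
    (hd : 2 * B < d) : countPairs d L = 0 := by
  induction L with
  | nil => rfl
  | cons p L ih =>
    rw [countPairs_cons, ih fun q hq => hB q (List.mem_cons_of_mem _ hq), countLeft]
    simp only [zero_add, List.length_eq_zero_iff, List.filter_eq_nil_iff, decide_eq_true_eq]
    intro q hq
    have := hB p (by simp)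
    have := hB q (List.mem_cons_of_mem _ hq)
    omega

lemma codingRun_le (w : Word 2) : (codingRun w).1.1 + (codingRun w).1.2 ≤ w.length ∧
    ∀ q ∈ (codingRun w).2, q.1 + q.2 ≤ w.length := by
  induction w with
  | nil => simp [codingRun]
  | cons a w ih =>
    have hrun : codingRun (a :: w) = codingStep a (codingRun w) := rfl
    rw [hrun, codingStep, List.length_cons]
    obtain ⟨h1, h2⟩ := ih
    split_ifs
    · exact ⟨by simp only; omega, fun q hq => (h2 q hq).trans (by omega)⟩
    · exact ⟨by simp only; omega, fun q hq => (h2 q hq).trans (by omega)⟩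
    · refine ⟨h1.trans (by omega), fun q hq => ?_⟩
      rcases List.mem_cons.1 hq with rfl | hq
      · omega
      · exact (h2 q hq).trans (by omega)

lemma primrec_codingRun : Primrec codingRun := by
  have hs : Primrec fun p : (Fin 2 × Bool) × ((ℕ × ℕ) × List (ℕ × ℕ)) => codingStep p.1 p.2 := by
    have p1 : Primrec fun p : (Fin 2 × Bool) × ((ℕ × ℕ) × List (ℕ × ℕ)) => p.2.1.1 :=
      Primrec.fst.comp (Primrec.fst.comp Primrec.snd)
    have p2 : Primrec fun p : (Fin 2 × Bool) × ((ℕ × ℕ) × List (ℕ × ℕ)) => p.2.1.2 :=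
      Primrec.snd.comp (Primrec.fst.comp Primrec.snd)
    refine Primrec.ite (Primrec.eq.comp (Primrec.fst.comp Primrec.fst) (Primrec.const 0))
      (Primrec.pair (Primrec.ite (Primrec.eq.comp (Primrec.snd.comp Primrec.fst)
        (Primrec.const true)) (Primrec.pair (Primrec.succ.comp p1) p2)
        (Primrec.pair p1 (Primrec.succ.comp p2))) (Primrec.snd.comp Primrec.snd))
      (Primrec.pair (Primrec.fst.comp Primrec.snd) (Primrec.list_cons.comp
        (Primrec.fst.comp Primrec.snd) (Primrec.snd.comp Primrec.snd)))
  exact Primrec.list_foldr Primrec.id (Primrec.const _) (hs.comp Primrec.snd).to₂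

lemma primrec_countLeft :
    Primrec fun p : ℕ × (ℕ × ℕ) × List (ℕ × ℕ) => countLeft p.1 p.2.1 p.2.2 := by
  have : PrimrecRel fun (q : ℕ × ℕ) (p : ℕ × ℕ × ℕ) => p.2.1 + q.2 = q.1 + p.2.2 + p.1 :=
    Primrec.eq.comp
      (Primrec.nat_add.comp (Primrec.fst.comp (Primrec.snd.comp Primrec.snd))
        (Primrec.snd.comp Primrec.fst))
      (Primrec.nat_add.comp (Primrec.nat_add.comp (Primrec.fst.comp Primrec.fst)
        (Primrec.snd.comp (Primrec.snd.comp Primrec.snd))) (Primrec.fst.comp Primrec.snd))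
  exact Primrec.list_length.comp (this.listFilter.comp (Primrec.snd.comp Primrec.snd)
    (Primrec.pair Primrec.fst (Primrec.fst.comp Primrec.snd)))

lemma primrec_countPairs : Primrec₂ countPairs := by
  refine Primrec.fst.comp (Primrec.list_foldr (f := fun p : ℕ × List (ℕ × ℕ) => p.2)
    (g := fun _ => ((0, []) : ℕ × List (ℕ × ℕ)))
    (h := fun d p => (p.2.1 + countLeft d.1 p.1 p.2.2, p.1 :: p.2.2)) Primrec.snd
    (Primrec.const _) ?_)
  refine (Primrec.pair (Primrec.nat_add.comp (Primrec.fst.comp (Primrec.snd.comp Primrec.snd))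
    (primrec_countLeft.comp (Primrec.pair (Primrec.fst.comp Primrec.fst)
      (Primrec.pair (Primrec.fst.comp Primrec.snd)
        (Primrec.snd.comp (Primrec.snd.comp Primrec.snd))))))
    (Primrec.list_cons.comp (Primrec.fst.comp Primrec.snd)
      (Primrec.snd.comp (Primrec.snd.comp Primrec.snd)))).to₂

lemma setReducible_wordProblem_codingGen (X : Set ℕ) :
    SetReducible (wordProblem (codingGen X)) X := by
  have hrun1 : Primrec fun w : Word 2 => (codingRun w).1 := Primrec.fst.comp primrec_codingRun
  have hrun2 : Primrec fun w : Word 2 => (codingRun w).2 := Primrec.snd.comp primrec_codingRun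
  have heven : PrimrecPred fun n : ℕ => Even n :=
    (Primrec.eq.comp (Primrec.nat_mod.comp Primrec.id (Primrec.const 2))
      (Primrec.const 0)).of_eq fun n => Nat.even_iff.symm
  have hsw : PrimrecRel fun (q : ℕ × ℕ) (L : List (ℕ × ℕ)) => Even (countLeft 0 q L) :=
    heven.comp (primrec_countLeft.comp (Primrec.pair (Primrec.const 0) Primrec.id))
  have hpair : PrimrecRel fun (k : ℕ) (p : List (ℕ × ℕ) × List Bool) =>
      p.2[k]? = some true → Even (countPairs (k + 1) p.1) :=
    (((Primrec.eq.comp (Primrec.list_getElem?.comp (Primrec.snd.comp Primrec.snd) Primrec.fst)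
      (Primrec.const (some true))).not).or (heven.comp (primrec_countPairs.comp
        (Primrec.succ.comp Primrec.fst) (Primrec.fst.comp Primrec.snd)))).of_eq
      fun p => imp_iff_not_or.symm
  have hQ : PrimrecPred fun p : Word 2 × List Bool =>
      (codingRun p.1).1.1 = (codingRun p.1).1.2 ∧
      (∀ q ∈ (codingRun p.1).2, Even (countLeft 0 q (codingRun p.1).2)) ∧
      ∀ k ∈ List.range p.2.length, p.2[k]? = some true →
        Even (countPairs (k + 1) (codingRun p.1).2) :=
    (Primrec.eq.comp (Primrec.fst.comp (hrun1.comp Primrec.fst))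
      (Primrec.snd.comp (hrun1.comp Primrec.fst))).and
    ((hsw.forall_mem_list.comp (hrun2.comp Primrec.fst) (hrun2.comp Primrec.fst)).and
    (hpair.forall_mem_list.comp (Primrec.list_range.comp (Primrec.list_length.comp Primrec.snd))
      (Primrec.pair (hrun2.comp Primrec.fst) Primrec.snd)))
  have hb : Primrec fun w : Word 2 => 2 * w.length + 1 :=
    Primrec.nat_double_succ.comp Primrec.list_length
  have := setReducible_of_decode (X := X) hQ hb
  convert this using 1
  ext c
  refine exists_congr fun w => and_congr_right fun _ => ?_
  rw [evalWord_codingGen_eq_one_iff]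
  refine and_congr_right fun _ => and_congr_right fun _ => ?_
  simp only [initSeg_length, List.mem_range, initSeg_getElem?]
  refine forall_congr' fun k => ⟨fun h hk hX => h (by simpa [hk] using hX), fun h hX => ?_⟩
  by_cases hk : k < 2 * w.length + 1
  · exact h hk (by simpa [hk] using hX)
  · rw [countPairs_eq_zero (codingRun_le w).2 (by omega)]
    exact Even.zero

/-- The commutator of a switch and of its conjugate at distance `k + 1`. -/
def codingWord (k : ℕ) : Word 2 :=
  (1, true) :: (List.replicate (k + 1) (0, true) ++ (1, true) ::
    (List.replicate (k + 1) (0, false) ++ (1, true) :: (List.replicate (k + 1) (0, true) ++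
      (1, true) :: List.replicate (k + 1) (0, false))))

lemma foldr_codingStep_replicate (b : Bool) (m : ℕ) (s : (ℕ × ℕ) × List (ℕ × ℕ)) :
    (List.replicate m ((0 : Fin 2), b)).foldr codingStep s =
      (if b then (s.1.1 + m, s.1.2) else (s.1.1, s.1.2 + m), s.2) := by
  induction m with
  | zero => simp
  | succ m ih =>
    rw [List.replicate_succ, List.foldr_cons, ih, codingStep]
    cases b <;> simp [add_assoc]

lemma codingRun_codingWord (k : ℕ) : codingRun (codingWord k) =
    ((2 * k + 2, 2 * k + 2),
      [(2 * k + 2, 2 * k + 2), (k + 1, 2 * k + 2), (k + 1, k + 1), (0, k + 1)]) := by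
  simp only [codingRun, codingWord, List.foldr_cons, List.foldr_append,
    foldr_codingStep_replicate]
  simp [codingStep]
  omega

lemma evalWord_codingWord_eq_one_iff (X : Set ℕ) (k : ℕ) :
    evalWord (codingGen X) (codingWord k) = 1 ↔ k ∉ X := by
  rw [evalWord_codingGen_eq_one_iff, codingRun_codingWord]
  have hpairs : ∀ j, countPairs (j + 1) [(2 * k + 2, 2 * k + 2), (k + 1, 2 * k + 2),
      (k + 1, k + 1), (0, k + 1)] = if j = k then 3 else 0 := by
    intro j
    simp only [countPairs_cons, countPairs_nil, countLeft, List.filter_cons, List.filter_nil,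
      decide_eq_true_eq]
    split_ifs <;> (try simp only [List.length_cons, List.length_nil]) <;> omega
  have hsw : ∀ q ∈ [(2 * k + 2, 2 * k + 2), (k + 1, 2 * k + 2), (k + 1, k + 1), (0, k + 1)],
      countLeft 0 q [(2 * k + 2, 2 * k + 2), (k + 1, 2 * k + 2), (k + 1, k + 1), (0, k + 1)]
        = 2 := by
    intro q hq
    simp only [List.mem_cons, List.not_mem_nil, or_false] at hq
    rcases hq with rfl | rfl | rfl | rfl <;>
    · simp only [countLeft, List.filter_cons, List.filter_nil, decide_eq_true_eq]
      split_ifs <;> (try simp only [List.length_cons, List.length_nil]) <;> omega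
  constructor
  · rintro ⟨-, -, h⟩ hk
    have := h k hk
    rw [hpairs, if_pos rfl] at this
    exact absurd this (by decide)
  · refine fun hk => ⟨rfl, fun q hq => ?_, fun j hj => ?_⟩
    · rw [hsw q hq]; exact even_two
    · rw [hpairs, if_neg (by rintro rfl; exact hk hj)]; exact Even.zero

lemma primrec_codingWord : Primrec codingWord := by
  have hr : ∀ x : Fin 2 × Bool, Primrec fun k : ℕ => List.replicate (k + 1) x := fun x =>
    (Primrec.list_map (Primrec.list_range.comp Primrec.succ) (Primrec.const x).to₂).of_eq
      fun k => by simp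
  have hc : ∀ {f : ℕ → Word 2}, Primrec f → Primrec fun k => ((1 : Fin 2), true) :: f k :=
    fun hf => Primrec.list_cons.comp (Primrec.const _) hf
  exact hc (Primrec.list_append.comp (hr _) (hc (Primrec.list_append.comp (hr _)
    (hc (Primrec.list_append.comp (hr _) (hc (hr _)))))))

lemma setReducible_codingGen (X : Set ℕ) : SetReducible X (wordProblem (codingGen X)) := by
  refine setReducible_of_primrec (b := fun k => encode (codingWord k) + 1)
    (P := fun p => ¬ p.2[encode (codingWord p.1)]? = some true)
    (Primrec.eq.comp (Primrec.list_getElem?.comp Primrec.snd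
      (Primrec.encode.comp (primrec_codingWord.comp Primrec.fst))) (Primrec.const _)).not
    (Primrec.succ.comp (Primrec.encode.comp primrec_codingWord)) fun k => ?_
  have : encode (codingWord k) ∈ wordProblem (codingGen X) ↔ k ∉ X := by
    rw [← evalWord_codingWord_eq_one_iff X k]
    exact ⟨fun ⟨_, hw, h⟩ => encode_injective hw ▸ h, fun h => ⟨_, rfl, h⟩⟩
  simp [initSeg_getElem?, this]

end CodingGroup

/-- The retraction of the free group that kills the letters `≥ n`. -/
def truncate (n : ℕ) : FreeGroup ℕ →* FreeGroup ℕ :=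
  FreeGroup.lift fun i => if i < n then FreeGroup.of i else 1

lemma truncate_of_lt {n i : ℕ} (h : i < n) : truncate n (FreeGroup.of i) = FreeGroup.of i := by
  simp [truncate, h]

lemma truncate_of_le {n i : ℕ} (h : n ≤ i) : truncate n (FreeGroup.of i) = 1 := by
  simp [truncate, Nat.not_lt.2 h]

lemma truncate_truncate {m n : ℕ} (h : m ≤ n) (x : FreeGroup ℕ) :
    truncate n (truncate m x) = truncate m x := by
  suffices (truncate n).comp (truncate m) = truncate m from DFunLike.congr_fun this x
  ext i
  by_cases hi : i < m
  · simp [truncate_of_lt hi, truncate_of_lt (hi.trans_le h)]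
  · simp [truncate_of_le (not_lt.1 hi)]

lemma truncate_eq_self_mono {m n : ℕ} (h : m ≤ n) {x : FreeGroup ℕ} (hx : truncate m x = x) :
    truncate n x = x := by
  rw [← hx, truncate_truncate h]

lemma exists_truncate_eq_self (x : FreeGroup ℕ) : ∃ n, truncate n x = x := by
  induction x using FreeGroup.induction_on with
  | C1 => exact ⟨0, map_one _⟩
  | of i => exact ⟨i + 1, truncate_of_lt (Nat.lt_succ_self i)⟩
  | inv_of i h => exact ⟨i + 1, by rw [map_inv, truncate_of_lt (Nat.lt_succ_self i)]⟩
  | mul x y hx hy =>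
    obtain ⟨m, hm⟩ := hx
    obtain ⟨n, hn⟩ := hy
    exact ⟨max m n, by rw [map_mul, truncate_eq_self_mono (le_max_left _ _) hm,
      truncate_eq_self_mono (le_max_right _ _) hn]⟩

lemma exists_forall_truncate_eq_self {k : ℕ} (x : Fin k → FreeGroup ℕ) :
    ∃ m, ∀ n ≥ m, ∀ i, truncate n (x i) = x i := by
  choose n hn using fun i => exists_truncate_eq_self (x i)
  exact ⟨Finset.univ.sup n, fun m hm i =>
    truncate_eq_self_mono ((Finset.le_sup (Finset.mem_univ i)).trans hm) (hn i)⟩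

lemma truncate_mk (n : ℕ) (w : List (ℕ × Bool)) :
    truncate n (FreeGroup.mk w) = FreeGroup.mk (w.filter fun a => a.1 < n) := by
  rw [truncate, FreeGroup.lift_mk]
  induction w with
  | nil => rfl
  | cons a w ih =>
    obtain ⟨i, b⟩ := a
    rw [List.map_cons, List.prod_cons, ih, List.filter_cons]
    by_cases h : i < n
    · cases b <;> simp [h, FreeGroup.of, FreeGroup.inv_mk, FreeGroup.invRev, FreeGroup.mul_mk]
    · cases b <;> simp [h]

/-- Two homomorphisms that agree on the letters `< n` agree on the words in these letters. -/
lemma map_truncate_congr {G : Type*} [Group G] {n : ℕ} {f g : FreeGroup ℕ →* G}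
    (h : ∀ i < n, f (FreeGroup.of i) = g (FreeGroup.of i)) (x : FreeGroup ℕ) :
    f (truncate n x) = g (truncate n x) := by
  suffices f.comp (truncate n) = g.comp (truncate n) from DFunLike.congr_fun this x
  ext i
  by_cases hi : i < n
  · simp [truncate_of_lt hi, h i hi]
  · simp [truncate_of_le (not_lt.1 hi)]

/-- The subgroups `K` and `L` contain the same words in the letters `< n`. -/
def AgreeBelow (n : ℕ) (K L : Subgroup (FreeGroup ℕ)) : Prop :=
  ∀ x, truncate n x ∈ K ↔ truncate n x ∈ L

section

variable {S : Set (Set ℕ)}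

open Classical in
lemma IsScottSet.decode_finite_mem (hS : IsScottSet S) {β : Type} [Primcodable β] [Finite β]
    (P : β → Prop) : {c | ∃ b : β, encode b = c ∧ P b} ∈ S := by
  obtain ⟨X, hX⟩ := hS.nonempty
  refine hS.of_reducible X hX _ (setReducible_of_decode (X := X) (b := fun _ => 0)
    (Q := fun p : β × List Bool => P p.1) ?_ (Primrec.const 0))
  exact ⟨inferInstance, (Primrec.dom_finite fun b => decide (P b)).comp Primrec.fst⟩

lemma IsScottSet.exists_agreeBelow (hS : IsScottSet S) {n : ℕ} {K N : Subgroup (FreeGroup ℕ)}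
    (hK : wordSet K ∈ S) [N.Normal] (hKN : AgreeBelow n K N) {α : Type} [Primcodable α]
    {e : α → List (ℕ × Bool)} (he : Primrec e)
    (hN : {c | ∃ a, encode a = c ∧ FreeGroup.mk (e a) ∈ N} ∈ S) :
    ∃ K' : Subgroup (FreeGroup ℕ), K'.Normal ∧ wordSet K' ∈ S ∧ AgreeBelow n K K' ∧
      ∀ a, FreeGroup.mk (e a) ∈ K' ↔ FreeGroup.mk (e a) ∈ N := by
  have hfilter : Primrec fun w : List (ℕ × Bool) => w.filter fun a => a.1 < n :=
    Primrec.listFilter (p := fun a : ℕ × Bool => a.1 < n)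
      (Primrec.nat_lt.comp Primrec.fst (Primrec.const n))
  have hsum : Primrec (Sum.elim (fun w : List (ℕ × Bool) => w.filter fun a => a.1 < n) e) :=
    (Primrec.sumCasesOn Primrec.id (hfilter.comp Primrec.snd).to₂
      (he.comp Primrec.snd).to₂).of_eq fun x => by cases x <;> rfl
  obtain ⟨K', hK', hK'S, h⟩ := hS.exists_subgroup hsum N (by
    convert hS.join_mem _ (hS.decode_mem hK (Primrec.encode.comp hfilter)) _ hN using 1
    ext c
    simp only [join, Set.mem_ofPred_eq, Sum.exists, Sum.elim_inl, Sum.elim_inr, encode_inl,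
      encode_inr, encode_mem_wordSet, ← truncate_mk, hKN _]
    refine or_congr ⟨?_, ?_⟩ ⟨?_, ?_⟩
    · rintro ⟨w, rfl, hw⟩; exact ⟨_, ⟨w, rfl, hw⟩, rfl⟩
    · rintro ⟨_, ⟨w, rfl, hw⟩, rfl⟩; exact ⟨w, rfl, hw⟩
    · rintro ⟨w, rfl, hw⟩; exact ⟨_, ⟨w, rfl, hw⟩, rfl⟩
    · rintro ⟨_, ⟨w, rfl, hw⟩, rfl⟩; exact ⟨w, rfl, hw⟩)
  refine ⟨K', hK', hK'S, fun x => ?_, fun a => h (Sum.inr a)⟩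
  rw [hKN x]
  have := h (Sum.inl x.toWord)
  rw [Sum.elim_inl, ← truncate_mk, FreeGroup.mk_toWord] at this
  exact this.symm

end

lemma evalWord_eq_lift {G : Type*} [Group G] {n : ℕ} (g : Fin n → G) (w : Word n) :
    evalWord g w = FreeGroup.lift g (FreeGroup.mk w) := by
  rw [FreeGroup.lift_mk, evalWord]
  congr 2
  funext a
  cases a.2 <;> rfl

lemma map_evalWord {G H : Type*} [Group G] [Group H] (f : G →* H) {n : ℕ} (g : Fin n → G)
    (w : Word n) : f (evalWord g w) = evalWord (f ∘ g) w := by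
  rw [evalWord_eq_lift, evalWord_eq_lift, ← MonoidHom.comp_apply]
  congr 1
  ext i
  simp

lemma encode_mem_wordProblem {G : Type*} [Group G] {n : ℕ} {g : Fin n → G} {w : Word n} :
    encode w ∈ wordProblem g ↔ evalWord g w = 1 :=
  ⟨fun ⟨_, hw, h⟩ => encode_injective hw ▸ h, fun h => ⟨w, rfl, h⟩⟩

lemma wordProblem_comp {G H : Type*} [Group G] [Group H] {f : G →* H}
    (hf : Function.Injective f) {n : ℕ} (g : Fin n → G) :
    wordProblem (f ∘ g) = wordProblem g := by
  simp only [wordProblem, ← map_evalWord, map_eq_one_iff f hf]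

lemma truncate_evalWord_eq_self {n k : ℕ} {x : Fin k → FreeGroup ℕ}
    (hx : ∀ i, truncate n (x i) = x i) (w : Word k) :
    truncate n (evalWord x w) = evalWord x w := by
  rw [map_evalWord, show truncate n ∘ x = x from funext hx]

/-- The word in the letters of the free group obtained by substituting `x` into a word. -/
def substWord {k : ℕ} (x : Fin k → FreeGroup ℕ) (w : Word k) : List (ℕ × Bool) :=
  w.flatMap fun a => if a.2 then (x a.1).toWord else (x a.1)⁻¹.toWord

lemma mk_substWord {k : ℕ} (x : Fin k → FreeGroup ℕ) (w : Word k) :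
    FreeGroup.mk (substWord x w) = evalWord x w := by
  induction w with
  | nil => rfl
  | cons a w ih =>
    rw [substWord, List.flatMap_cons, ← FreeGroup.mul_mk]
    change _ * FreeGroup.mk (substWord x w) = _
    rw [ih]
    obtain ⟨i, b⟩ := a
    cases b
    · simp only [Bool.false_eq_true, if_false, FreeGroup.mk_toWord]
      simp [evalWord]
    · simp only [if_true, FreeGroup.mk_toWord]
      simp [evalWord]

lemma primrec_substWord {k : ℕ} (x : Fin k → FreeGroup ℕ) : Primrec (substWord x) :=
  Primrec.list_flatMap Primrec.id ((Primrec.dom_finite fun a : Fin k × Bool =>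
    if a.2 then (x a.1).toWord else (x a.1)⁻¹.toWord).comp Primrec.snd).to₂

section

variable {S : Set (Set ℕ)}

/-- The tuple `y` extended to the letters `≥ n`, and `z` on the letters `< n`. -/
def glue {G : Type*} [Group G] (n : ℕ) {k : ℕ} (z : FreeGroup ℕ →* G) (y : Fin k → G) :
    FreeGroup ℕ →* G :=
  FreeGroup.lift fun i => if i < n then z (FreeGroup.of i)
    else if h : i - n < k then y ⟨i - n, h⟩ else 1

lemma glue_truncate {G : Type*} [Group G] {n k : ℕ} (z : FreeGroup ℕ →* G) (y : Fin k → G)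
    (x : FreeGroup ℕ) : glue n z y (truncate n x) = z (truncate n x) :=
  map_truncate_congr (fun i hi => by simp [glue, hi]) x

lemma glue_of_add {G : Type*} [Group G] {n k : ℕ} (z : FreeGroup ℕ →* G) (y : Fin k → G)
    (i : Fin k) : glue n z y (FreeGroup.of (n + i)) = y i := by
  simp [glue]

/-- A finite system of equations and inequations with parameters below `n` that is solvable over
a stage can be solved by fresh letters. -/
lemma IsScottSet.exists_solution (hS : IsScottSet S) {n : ℕ} {K : Subgroup (FreeGroup ℕ)}
    (hK : wordSet K ∈ S) {k l : ℕ} (u : Fin l → FreeGroup ℕ) (hu : ∀ i, truncate n (u i) = u i)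
    (T : List (FreeGroup (Fin k ⊕ Fin l) × Bool)) {G : Type} [Group G] (z : FreeGroup ℕ →* G)
    (y : Fin k → G) (hz : ∀ x, z (truncate n x) = 1 ↔ truncate n x ∈ K)
    (hT : ∀ t ∈ T, FreeGroup.lift (Sum.elim y (z ∘ u)) t.1 = 1 ↔ t.2 = true) :
    ∃ K' : Subgroup (FreeGroup ℕ), K'.Normal ∧ wordSet K' ∈ S ∧ AgreeBelow n K K' ∧
      ∃ x : Fin k → FreeGroup ℕ, (∀ i, truncate (n + k) (x i) = x i) ∧
        ∀ t ∈ T, FreeGroup.lift (Sum.elim x u) t.1 ∈ K' ↔ t.2 = true := by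
  let x : Fin k → FreeGroup ℕ := fun i => FreeGroup.of (n + i)
  have hglue : ∀ t, glue n z y (FreeGroup.lift (Sum.elim x u) t) =
      FreeGroup.lift (Sum.elim y (z ∘ u)) t := by
    intro t
    rw [← MonoidHom.comp_apply]
    congr 1
    ext i
    rcases i with i | j
    · simp [x, glue_of_add]
    · simp only [MonoidHom.comp_apply, FreeGroup.lift_apply_of, Sum.elim_inr, Function.comp]
      rw [← hu j, glue_truncate]
  obtain ⟨K', hK', hK'S, hKK', h⟩ := hS.exists_agreeBelow (N := (glue n z y).ker) hK
    (fun x => by rw [MonoidHom.mem_ker, glue_truncate, hz])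
    (Primrec.dom_finite fun i : Fin T.length =>
      (FreeGroup.lift (Sum.elim x u) (T.get i).1).toWord)
    (hS.decode_finite_mem _)
  refine ⟨K', hK', hK'S, hKK', x, fun i => truncate_of_lt (by omega), fun t ht => ?_⟩
  obtain ⟨i, rfl⟩ := List.get_of_mem ht
  have := h i
  rw [FreeGroup.mk_toWord, MonoidHom.mem_ker, hglue] at this
  exact this.trans (hT _ ht)

/-- A group with word problem in the Scott set can be added by fresh letters. -/
lemma IsScottSet.exists_tuple (hS : IsScottSet S) {n : ℕ} {K : Subgroup (FreeGroup ℕ)} [K.Normal]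
    (hK : wordSet K ∈ S) {k : ℕ} {G : Type} [Group G] (y : Fin k → G)
    (hy : wordProblem y ∈ S) :
    ∃ K' : Subgroup (FreeGroup ℕ), K'.Normal ∧ wordSet K' ∈ S ∧ AgreeBelow n K K' ∧
      ∃ x : Fin k → FreeGroup ℕ, (∀ i, truncate (n + k) (x i) = x i) ∧
        ∀ w, evalWord x w ∈ K' ↔ encode w ∈ wordProblem y := by
  let x : Fin k → FreeGroup ℕ := fun i => FreeGroup.of (n + i)
  let f := glue n ((MonoidHom.inl (FreeGroup ℕ ⧸ K) G).comp (QuotientGroup.mk' K))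
    (MonoidHom.inr (FreeGroup ℕ ⧸ K) G ∘ y)
  have hf : ∀ w, f (evalWord x w) = 1 ↔ evalWord y w = 1 := by
    intro w
    have : f ∘ x = MonoidHom.inr (FreeGroup ℕ ⧸ K) G ∘ y := funext fun i => glue_of_add _ _ i
    rw [map_evalWord, this, ← map_evalWord, map_eq_one_iff]
    exact fun a b h => (Prod.ext_iff.1 h).2
  obtain ⟨K', hK', hK'S, hKK', h⟩ := hS.exists_agreeBelow (N := f.ker) hK
    (fun x => by
      rw [MonoidHom.mem_ker, glue_truncate, MonoidHom.comp_apply, map_eq_one_iff]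
      · exact (QuotientGroup.eq_one_iff _).symm
      · exact fun a b h => (Prod.ext_iff.1 h).1)
    (primrec_substWord x)
    (by simp only [mk_substWord, MonoidHom.mem_ker, hf]; exact hy)
  refine ⟨K', hK', hK'S, hKK', x, fun i => truncate_of_lt (by omega), fun w => ?_⟩
  have := h w
  rwa [mk_substWord, MonoidHom.mem_ker, hf, ← encode_mem_wordProblem] at this

end

/-- Given countably many tasks each of which can be handled at each stage, there is a sequence of
stages in which each task is handled infinitely often. -/
lemma exists_seq_tasks {A B : Type*} [Countable B] [Nonempty B] (R : B → A → A → Prop)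
    (h : ∀ b a, ∃ a', R b a a') (a₀ : A) :
    ∃ f : ℕ → A, (∀ i, ∃ b, R b (f i) (f (i + 1))) ∧
      ∀ b m, ∃ i ≥ m, R b (f i) (f (i + 1)) := by
  obtain ⟨g, hg⟩ := exists_surjective_nat B
  choose F hF using h
  let f : ℕ → A := fun i => Nat.rec a₀ (fun i a => F (g i.unpair.1) a) i
  have hf : ∀ i, R (g i.unpair.1) (f i) (f (i + 1)) := fun i => hF _ _
  refine ⟨f, fun i => ⟨_, hf i⟩, fun b m => ?_⟩
  obtain ⟨c, rfl⟩ := hg b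
  refine ⟨Nat.pair c m, Nat.right_le_pair c m, ?_⟩
  have := hf (Nat.pair c m)
  rwa [Nat.unpair_pair] at this

section

variable {S : Set (Set ℕ)}

/-- A stage of the construction: a normal subgroup whose word problem is in the Scott set, of which
only the words in the letters `< n` matter. -/
structure Stage (S : Set (Set ℕ)) where
  n : ℕ
  K : Subgroup (FreeGroup ℕ)
  normal : K.Normal
  mem : wordSet K ∈ S

/-- The stage `t` extends the stage `s`. -/
def Stage.Extends (s t : Stage S) : Prop := s.n < t.n ∧ AgreeBelow s.n s.K t.K

/-- A task: to solve a finite system of equations and inequations with given parameters, or to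
realize a given word problem. -/
abbrev Task (S : Set (Set ℕ)) : Type :=
  (Σ k l : ℕ, (Fin l → FreeGroup ℕ) × List (FreeGroup (Fin k ⊕ Fin l) × Bool)) ⊕ (ℕ × S)

/-- The stage `t` handles a task that is feasible at the stage `s`. -/
def Handles (s t : Stage S) : Task S → Prop
  | .inl ⟨k, _, u, T⟩ => (∀ i, truncate s.n (u i) = u i) →
      (∃ (G : Type) (_ : Group G) (z : FreeGroup ℕ →* G) (y : Fin k → G),
        (∀ x, z (truncate s.n x) = 1 ↔ truncate s.n x ∈ s.K) ∧
        ∀ p ∈ T, FreeGroup.lift (Sum.elim y (z ∘ u)) p.1 = 1 ↔ p.2 = true) →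
      ∃ x : Fin k → FreeGroup ℕ, (∀ i, truncate t.n (x i) = x i) ∧
        ∀ p ∈ T, FreeGroup.lift (Sum.elim x u) p.1 ∈ t.K ↔ p.2 = true
  | .inr ⟨k, Y⟩ => (∃ (G : Type) (_ : Group G) (y : Fin k → G), wordProblem y = Y) →
      ∃ x : Fin k → FreeGroup ℕ, (∀ i, truncate t.n (x i) = x i) ∧
        ∀ w, evalWord x w ∈ t.K ↔ encode w ∈ (Y : Set ℕ)

lemma IsScottSet.exists_handles (hS : IsScottSet S) (τ : Task S) (s : Stage S) :
    ∃ t : Stage S, s.Extends t ∧ Handles s t τ := by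
  have hn := s.normal
  have trivial_ext : ∃ t : Stage S, s.Extends t :=
    ⟨⟨s.n + 1, s.K, s.normal, s.mem⟩, Nat.lt_succ_self _, fun _ => Iff.rfl⟩
  rcases τ with ⟨k, l, u, T⟩ | ⟨k, Y, hY⟩
  · by_cases hu : ∀ i, truncate s.n (u i) = u i
    · by_cases hG : ∃ (G : Type) (_ : Group G) (z : FreeGroup ℕ →* G) (y : Fin k → G),
        (∀ x, z (truncate s.n x) = 1 ↔ truncate s.n x ∈ s.K) ∧
        ∀ p ∈ T, FreeGroup.lift (Sum.elim y (z ∘ u)) p.1 = 1 ↔ p.2 = true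
      · have hG' := hG
        obtain ⟨G, _, z, y, hz, hT⟩ := hG'
        obtain ⟨K', h1, h2, h3, x, hx, hx'⟩ := hS.exists_solution s.mem u hu T z y hz hT
        exact ⟨⟨s.n + k + 1, K', h1, h2⟩, ⟨by simp only; omega, h3⟩, fun _ _ =>
          ⟨x, fun i => truncate_eq_self_mono (Nat.le_succ _) (hx i), hx'⟩⟩
      · obtain ⟨t, ht⟩ := trivial_ext
        exact ⟨t, ht, fun _ h => (hG h).elim⟩
    · obtain ⟨t, ht⟩ := trivial_ext
      exact ⟨t, ht, fun h => (hu h).elim⟩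
  · by_cases hG : ∃ (G : Type) (_ : Group G) (y : Fin k → G), wordProblem y = Y
    · have hG' := hG
      obtain ⟨G, _, y, rfl⟩ := hG'
      obtain ⟨K', h1, h2, h3, x, hx, hx'⟩ := hS.exists_tuple (n := s.n) s.mem y hY
      exact ⟨⟨s.n + k + 1, K', h1, h2⟩, ⟨by simp only; omega, h3⟩, fun _ =>
        ⟨x, fun i => truncate_eq_self_mono (Nat.le_succ _) (hx i), hx'⟩⟩
    · obtain ⟨t, ht⟩ := trivial_ext
      exact ⟨t, ht, fun h => (hG h).elim⟩

/-- The union of a sequence of stages. -/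
def limitSubgroup (f : ℕ → Stage S) : Subgroup (FreeGroup ℕ) where
  carrier := {x | ∀ᶠ i in Filter.atTop, x ∈ (f i).K}
  one_mem' := Filter.Eventually.of_forall fun i => (f i).K.one_mem
  mul_mem' ha hb := by
    filter_upwards [ha, hb] with i h1 h2 using (f i).K.mul_mem h1 h2
  inv_mem' ha := by
    filter_upwards [ha] with i h using (f i).K.inv_mem h

instance limitSubgroup_normal (f : ℕ → Stage S) : (limitSubgroup f).Normal where
  conj_mem x hx g := by
    filter_upwards [show ∀ᶠ i in Filter.atTop, x ∈ (f i).K from hx] with i h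
      using (f i).normal.conj_mem x h g

lemma Stage.Extends.trans {s t r : Stage S} (h : s.Extends t) (h' : t.Extends r) :
    s.Extends r :=
  ⟨h.1.trans h'.1, fun x => by
    rw [h.2 x, ← truncate_truncate h.1.le x, h'.2]⟩

lemma extends_of_lt {f : ℕ → Stage S} (hf : ∀ i, (f i).Extends (f (i + 1))) {i j : ℕ}
    (h : i < j) : (f i).Extends (f j) := by
  induction j, h using Nat.le_induction with
  | base => exact hf i
  | succ j _ ih => exact ih.trans (hf j)

lemma le_stage_n {f : ℕ → Stage S} (hf : ∀ i, (f i).Extends (f (i + 1))) (i : ℕ) :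
    i ≤ (f i).n := by
  induction i with
  | zero => exact Nat.zero_le _
  | succ i ih => exact Nat.succ_le_of_lt (ih.trans_lt (hf i).1)

lemma mem_limitSubgroup_iff {f : ℕ → Stage S} (hf : ∀ i, (f i).Extends (f (i + 1))) (i : ℕ)
    {x : FreeGroup ℕ} (hx : truncate (f i).n x = x) : x ∈ limitSubgroup f ↔ x ∈ (f i).K := by
  have key : ∀ j > i, (x ∈ (f i).K ↔ x ∈ (f j).K) := fun j hj => by
    have := (extends_of_lt hf hj).2 x
    rwa [hx] at this
  constructor
  · intro h
    obtain ⟨j, hj, hij⟩ := (Filter.Eventually.and (show ∀ᶠ j in Filter.atTop, x ∈ (f j).K from h)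
      (Filter.eventually_gt_atTop i)).exists
    exact (key j hij).2 hj
  · intro h
    filter_upwards [Filter.eventually_gt_atTop i] with j hj using (key j hj).1 h

/-- The presentation of the group of the theorem. -/
lemma IsScottSet.exists_limit (hS : IsScottSet S) (hcount : S.Countable) :
    ∃ N : Subgroup (FreeGroup ℕ), N.Normal ∧
      (∀ {k : ℕ} (x : Fin k → FreeGroup ℕ), {c | ∃ w : Word k, encode w = c ∧
        evalWord x w ∈ N} ∈ S) ∧
      (∀ {k l : ℕ} (u : Fin l → FreeGroup ℕ) (T : List (FreeGroup (Fin k ⊕ Fin l) × Bool))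
        (G : Type) [Group G] (z : FreeGroup ℕ →* G) (y : Fin k → G), z.ker = N →
        (∀ p ∈ T, FreeGroup.lift (Sum.elim y (z ∘ u)) p.1 = 1 ↔ p.2 = true) →
        ∃ x : Fin k → FreeGroup ℕ,
          ∀ p ∈ T, FreeGroup.lift (Sum.elim x u) p.1 ∈ N ↔ p.2 = true) ∧
      ∀ {k : ℕ} (G : Type) [Group G] (y : Fin k → G), wordProblem y ∈ S →
        ∃ x : Fin k → FreeGroup ℕ, ∀ w, evalWord x w ∈ N ↔ evalWord y w = 1 := by
  have : Countable S := hcount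
  have : Countable (Task S) := by
    have h : ∀ α : Type, Countable α → Countable (FreeGroup α) := fun α _ => by
      classical exact FreeGroup.toWord_injective.countable
    have := h ℕ inferInstance
    have := fun k l : ℕ => h (Fin k ⊕ Fin l) inferInstance
    infer_instance
  have htop : wordSet ⊤ ∈ S := by
    obtain ⟨X, hX⟩ := hS.nonempty
    refine hS.of_reducible X hX _ (setReducible_of_decode (X := X) (b := fun _ => 0)
      (Q := fun p : List (ℕ × Bool) × List Bool => FreeGroup.mk p.1 ∈ (⊤ : Subgroup (FreeGroup ℕ)))
      ((Primrec.eq.comp (Primrec.const 0) (Primrec.const 0)).of_eq fun p => by simp)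
      (Primrec.const 0))
  have : Nonempty (Task S) := ⟨.inl ⟨0, 0, Fin.elim0, []⟩⟩
  obtain ⟨f, hf, hτ⟩ := exists_seq_tasks (fun τ s t => Stage.Extends s t ∧ Handles s t τ)
    hS.exists_handles (⟨0, ⊤, inferInstance, htop⟩ : Stage S)
  replace hf : ∀ i, (f i).Extends (f (i + 1)) := fun i => (hf i).choose_spec.1
  refine ⟨limitSubgroup f, inferInstance, fun x => ?_, fun {k l} u T G _ z y hz hT => ?_,
    fun {k} G _ y hy => ?_⟩
  · obtain ⟨m, hm⟩ := exists_forall_truncate_eq_self x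
    have hx := hm _ (le_stage_n hf m)
    have := hS.decode_mem (f m).mem (Primrec.encode.comp (primrec_substWord x))
    simp only [encode_mem_wordSet, mk_substWord] at this
    simpa only [mem_limitSubgroup_iff hf m (truncate_evalWord_eq_self hx _)] using this
  · obtain ⟨m, hm⟩ := exists_forall_truncate_eq_self u
    obtain ⟨i, hi, -, h⟩ := hτ (.inl ⟨k, l, u, T⟩) m
    have hu := hm _ (hi.trans (le_stage_n hf i))
    obtain ⟨x, hx, hx'⟩ := h hu ⟨G, inferInstance, z, y, fun x => by
      rw [← MonoidHom.mem_ker, hz, mem_limitSubgroup_iff hf i (truncate_truncate le_rfl x)], hT⟩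
    refine ⟨x, fun p hp => ?_⟩
    rw [← hx' p hp, mem_limitSubgroup_iff hf (i + 1)]
    rw [← MonoidHom.comp_apply]
    congr 1
    ext j
    rcases j with j | j
    · simp [hx]
    · simp [truncate_eq_self_mono (hf i).1.le (hu j)]
  · obtain ⟨i, -, -, h⟩ := hτ (.inr ⟨k, _, hy⟩) 0
    obtain ⟨x, hx, hx'⟩ := h ⟨G, inferInstance, y, rfl⟩
    refine ⟨x, fun w => ?_⟩
    rw [mem_limitSubgroup_iff hf (i + 1) (truncate_evalWord_eq_self hx w), hx',
      encode_mem_wordProblem]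

end

section QuantifierFree

open FirstOrder Language

lemma exists_freeGroup_term {α : Type} (t : groupLang.Term (α ⊕ Fin 0)) :
    ∃ w : FreeGroup α, ∀ (G : Type) [Group G] (v : α → G),
      t.realize (Sum.elim v default) = FreeGroup.lift v w := by
  induction t with
  | var i =>
    rcases i with i | i
    · exact ⟨FreeGroup.of i, fun G _ v => by simp⟩
    · exact i.elim0
  | func F ts ih =>
    choose w hw using ih
    cases F with
    | one => exact ⟨1, fun G _ v => by rw [map_one]; rfl⟩
    | mul =>
      refine ⟨w 0 * w 1, fun G _ v => ?_⟩
      rw [map_mul, ← hw, ← hw]; rfl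
    | inv =>
      refine ⟨(w 0)⁻¹, fun G _ v => ?_⟩
      rw [map_inv, ← hw]; rfl

/-- The truth of a quantifier-free formula depends only on the truth of finitely many
equations. -/
lemma exists_equations_of_isQF {α : Type} (φ : groupLang.Formula α)
    (hφ : BoundedFormula.IsQF φ) : ∃ T : List (FreeGroup α),
      ∀ (G H : Type) [Group G] [Group H] (v : α → G) (v' : α → H),
        (∀ w ∈ T, FreeGroup.lift v w = 1 ↔ FreeGroup.lift v' w = 1) →
        (φ.Realize v ↔ φ.Realize v') := by
  induction hφ with
  | falsum => exact ⟨[], fun _ _ _ _ _ _ _ => Iff.rfl⟩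
  | of_isAtomic h =>
    cases h with
    | equal t₁ t₂ =>
      obtain ⟨w₁, h₁⟩ := exists_freeGroup_term t₁
      obtain ⟨w₂, h₂⟩ := exists_freeGroup_term t₂
      refine ⟨[w₁ * w₂⁻¹], fun G H _ _ v v' h => ?_⟩
      have := h _ (List.mem_singleton_self _)
      rw [map_mul, map_mul, map_inv, map_inv, mul_inv_eq_one, mul_inv_eq_one] at this
      rw [Formula.Realize, Formula.Realize, BoundedFormula.realize_bdEqual,
        BoundedFormula.realize_bdEqual, h₁, h₂, h₁, h₂]
      exact this
    | rel R ts => exact R.elim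
  | imp _ _ ih₁ ih₂ =>
    obtain ⟨T₁, h₁⟩ := ih₁
    obtain ⟨T₂, h₂⟩ := ih₂
    refine ⟨T₁ ++ T₂, fun G H _ _ v v' h => ?_⟩
    exact imp_congr (h₁ G H v v' fun w hw => h w (List.mem_append_left _ hw))
      (h₂ G H v v' fun w hw => h w (List.mem_append_right _ hw))

end QuantifierFree

/-- Two tuples with the same word problem generate isomorphic groups. -/
lemma exists_injective_of_wordProblem_eq {G H : Type*} [Group G] [Group H] {n : ℕ} {g : Fin n → G}
    {h : Fin n → H} (hg : Generates g) (hgh : ∀ w, evalWord g w = 1 ↔ evalWord h w = 1) :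
    ∃ f : G →* H, Function.Injective f := by
  have hsurj : Function.Surjective (FreeGroup.lift g) := by
    rw [← MonoidHom.range_eq_top, FreeGroup.range_lift_eq_closure]
    exact hg
  have hker : (FreeGroup.lift g).ker = (FreeGroup.lift h).ker := by
    ext x
    induction x using Quot.ind with | mk w =>
    have := hgh w
    rw [evalWord_eq_lift, evalWord_eq_lift] at this
    exact this
  refine ⟨(FreeGroup.lift g).liftOfSurjective hsurj ⟨FreeGroup.lift h, hker.le⟩, ?_⟩
  rw [injective_iff_map_eq_one]
  intro a ha
  obtain ⟨x, rfl⟩ := hsurj a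
  have := MonoidHom.liftOfRightInverse_comp_apply (FreeGroup.lift g) _
    (Function.rightInverse_surjInv hsurj) ⟨FreeGroup.lift h, hker.le⟩ x
  have h1 : FreeGroup.lift h x = 1 := this.symm.trans ha
  rw [← MonoidHom.mem_ker, ← hker] at h1
  exact h1

lemma degree_eq_of_setReducible {X Y : Set ℕ} (h : SetReducible X Y) (h' : SetReducible Y X) :
    degree X = degree Y :=
  Quotient.sound ⟨h, h'⟩

/-- The group of the theorem: every finitely generated subgroup has word problem in the Scott
set, every word problem in the Scott set occurs, and the group is existentially closed. -/
lemma IsScottSet.exists_group {S : Set (Set ℕ)} (hS : IsScottSet S) (hcount : S.Countable) :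
    ∃ (M : Type) (_ : Group M), Countable M ∧ IsExistentiallyClosed M ∧
      (∀ {n : ℕ} (x : Fin n → M), wordProblem x ∈ S) ∧
      ∀ {n : ℕ} (G : Type) [Group G] (g : Fin n → G), wordProblem g ∈ S →
        ∃ x : Fin n → M, ∀ w, evalWord x w = 1 ↔ evalWord g w = 1 := by
  obtain ⟨N, hN, hmem, hsolve, htuple⟩ := hS.exists_limit hcount
  have heval : ∀ {n : ℕ} (x : Fin n → FreeGroup ℕ) (w : Word n),
      evalWord (QuotientGroup.mk' N ∘ x) w = 1 ↔ evalWord x w ∈ N := fun x w => by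
    rw [← map_evalWord]; exact QuotientGroup.eq_one_iff _
  have hlift : ∀ {n : ℕ} (x : Fin n → FreeGroup ℕ ⧸ N), ∃ y, x = QuotientGroup.mk' N ∘ y := by
    intro n x
    choose y hy using fun i => QuotientGroup.mk'_surjective N (x i)
    exact ⟨y, funext fun i => (hy i).symm⟩
  refine ⟨FreeGroup ℕ ⧸ N, inferInstance, ?_, ?_, ?_, ?_⟩
  · have : Countable (FreeGroup ℕ) := FreeGroup.toWord_injective.countable
    exact (QuotientGroup.mk'_surjective N).countable
  · intro k l φ hφ m ⟨H, _, ι, hι, y, hy⟩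
    obtain ⟨u, rfl⟩ := hlift m
    obtain ⟨T, hT⟩ := exists_equations_of_isQF φ hφ
    classical
    obtain ⟨x, hx⟩ := hsolve u
      (T.map fun w => (w, decide (FreeGroup.lift (Sum.elim y (ι ∘ QuotientGroup.mk' N ∘ u)) w = 1)))
      H (ι.comp (QuotientGroup.mk' N)) y
      (by
        ext x
        rw [MonoidHom.mem_ker, MonoidHom.comp_apply, map_eq_one_iff ι hι]
        exact QuotientGroup.eq_one_iff _)
      (by
        intro p hp
        obtain ⟨w, -, rfl⟩ := List.mem_map.1 hp
        rw [decide_eq_true_eq]; rfl)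
    refine ⟨QuotientGroup.mk' N ∘ x, (hT _ _ _ _ fun w hw => ?_).1 hy⟩
    have h1 := hx _ (List.mem_map_of_mem hw)
    simp only [decide_eq_true_eq] at h1
    rw [← h1, ← QuotientGroup.eq_one_iff, ← QuotientGroup.mk'_apply, ← MonoidHom.comp_apply]
    have : (QuotientGroup.mk' N).comp (FreeGroup.lift (Sum.elim x u)) =
        FreeGroup.lift (Sum.elim (QuotientGroup.mk' N ∘ x) (QuotientGroup.mk' N ∘ u)) := by
      ext i
      cases i <;> simp
    rw [this]
  · intro n x
    obtain ⟨y, rfl⟩ := hlift x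
    simp only [wordProblem, heval]
    exact hmem y
  · intro n G _ g hg
    obtain ⟨x, hx⟩ := htuple G g hg
    exact ⟨QuotientGroup.mk' N ∘ x, fun w => (heval x w).trans (hx w)⟩

end ECGroup

theorem mainTheorem7 (S : Set (Set ℕ)) (hS : ECGroup.IsScottSet S) (hcount : S.Countable) :
    ∃ (M : Type) (_ : Group M), Countable M ∧ ECGroup.IsExistentiallyClosed M ∧
      ECGroup.skeletonDegrees M = ECGroup.degree '' S ∧
      ∀ (G : Type*) [Group G] (n : ℕ) (g : Fin n → G), ECGroup.Generates g →
        ((∃ H ∈ ECGroup.skeleton M, Nonempty (G ≃* H)) ↔ ECGroup.wordProblem g ∈ S) := by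
  obtain ⟨M, _, hM, hec, hmem, htuple⟩ := hS.exists_group hcount
  refine ⟨M, inferInstance, hM, hec, Set.Subset.antisymm ?_ ?_, fun G _ n g hg => ⟨?_, fun h => ?_⟩⟩
  · rintro _ ⟨H, -, n, g, -, rfl⟩
    exact ⟨_, hmem (H.subtype ∘ g), by rw [ECGroup.wordProblem_comp H.subtype_injective]⟩
  · rintro _ ⟨X, hX, rfl⟩
    have hW := ECGroup.setReducible_wordProblem_codingGen X
    obtain ⟨x, hx⟩ := htuple _ (ECGroup.codingGen X) (hS.of_reducible X hX _ hW)
    have hg : (Subgroup.closure (Set.range x)).subtype ∘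
        (fun i => ⟨x i, Subgroup.subset_closure ⟨i, rfl⟩⟩ : Fin 2 → _) = x := rfl
    refine ⟨Subgroup.closure (Set.range x), (Subgroup.fg_iff _).2 ⟨_, rfl, Set.finite_range x⟩, 2,
      fun i => ⟨x i, Subgroup.subset_closure ⟨i, rfl⟩⟩, ?_, ?_⟩
    · rw [ECGroup.Generates, ← Subgroup.closure_closure_coe_preimage (k := Set.range x)]
      congr 1
      ext ⟨y, hy⟩
      simp
    · rw [← ECGroup.wordProblem_comp (Subgroup.subtype_injective _), hg]
      have : ECGroup.wordProblem x = ECGroup.wordProblem (ECGroup.codingGen X) := by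
        simp only [ECGroup.wordProblem, hx]
      rw [this]
      exact ECGroup.degree_eq_of_setReducible (ECGroup.setReducible_codingGen X) hW
  · rintro ⟨H, -, ⟨f⟩⟩
    have hf : Function.Injective (H.subtype.comp f.toMonoidHom) := fun a b hab =>
      f.injective (H.subtype_injective hab)
    exact ECGroup.wordProblem_comp hf g ▸ hmem (H.subtype.comp f.toMonoidHom ∘ g)
  · have hmk : ∀ w, ECGroup.evalWord
        (QuotientGroup.mk' (FreeGroup.lift g).ker ∘ FreeGroup.of) w = 1 ↔
        ECGroup.evalWord g w = 1 := fun w => by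
      have : FreeGroup.lift (QuotientGroup.mk' (FreeGroup.lift g).ker ∘ FreeGroup.of) =
          QuotientGroup.mk' (FreeGroup.lift g).ker := by ext; simp
      rw [ECGroup.evalWord_eq_lift, ECGroup.evalWord_eq_lift, this]
      exact QuotientGroup.eq_one_iff _
    have hW : ECGroup.wordProblem (QuotientGroup.mk' (FreeGroup.lift g).ker ∘ FreeGroup.of) =
        ECGroup.wordProblem g := by
      simp only [ECGroup.wordProblem, hmk]
    obtain ⟨x, hx⟩ := htuple _ (QuotientGroup.mk' (FreeGroup.lift g).ker ∘ FreeGroup.of)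
      (hW ▸ h)
    obtain ⟨f, hf⟩ := ECGroup.exists_injective_of_wordProblem_eq hg fun w =>
      ((hx w).trans (hmk w)).symm
    have : Group.FG G := Group.fg_iff.2 ⟨_, hg, Set.finite_range g⟩
    exact ⟨f.range, (Group.fg_iff_subgroup_fg _).1 inferInstance, ⟨f.ofInjective hf⟩⟩
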